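/- All posets are finite and non-empty. For posets $A,B$ let $\mathcal H(A,B)$ be the set of order-preserving maps $A\to B$. Let $\mathfrak P_r$ be a representation system of the non-empty finite posets (exactly one member of each isomorphism class). For posets $A,B$ with disjoint carriers, the ordinal sum $A\oplus B$ is the poset on $A\cup B$ which keeps the orders of $A$ and $B$ and puts every element of $A$ below every element of $B$. For a subset $A$ of a poset $P$ let ${\downarrow}^\circ A=\{y\in P\setminus A: y\le a\text{ for some }a\in A\}$ and ${\uparrow}_\circ A=\{y\in P\setminus A: y\ge a\text{ for some }a\in A\}$; for $x\in P$ write ${\downarrow}^\circ x={\downarrow}^\circ\{x\}$ and ${\uparrow}_\circ x={\uparrow}_\circ\{x\}$. For $\xi\in\mathcal H(P,R)$ and $x\in P$ let $G_\xi(x)$ be the set of all $y\in P$ for which there are $x=z_0,z_1,\dots,z_L=y$ in $\xi^{-1}(\xi(x))$ such that $z_{\ell-1}<z_\ell$ or $z_{\ell-1}>z_\ell$ for every $\ell\in\{1,\dots,L\}$. The EV-system of a poset $P$ is $\mathcal E(P)=\{(x,D,U): x\in P,\ D\subseteq{\downarrow}^\circ x,\ U\subseteq{\uparrow}_\circ x\}$.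 For $\mathfrak a,\mathfrak b\in\mathcal E(P)$, $\mathfrak a<_+\mathfrak b$ means $\mathfrak a_1\in\mathfrak b_2$ and $\mathfrak b_1\in\mathfrak a_3$, and $\mathfrak a\le_+\mathfrak b$ means $\mathfrak a<_+\mathfrak b$ or $\mathfrak a=\mathfrak b$; homomorphisms between EV-systems are the maps preserving $\le_+$. For $\xi\in\mathcal H(P,R)$ and $x\in P$ let $\alpha_{P,\xi}(x)=(\xi(x),\ \xi({\downarrow}^\circ G_\xi(x)),\ \xi({\uparrow}_\circ G_\xi(x)))\in\mathcal E(R)$. A Hom-scheme from $R$ to $S$ is a family $\rho=(\rho_P)_{P\in\mathfrak P_r}$ of maps $\rho_P:\mathcal H(P,R)\to\mathcal H(P,S)$. It is strong if every $\rho_P$ is one-to-one; it is a G-scheme if $G_{\rho_P(\xi)}(x)=G_\xi(x)$ for all $P\in\mathfrak P_r$, $\xi\in\mathcal H(P,R)$, $x\in P$; it is an I-scheme if for all $P,P'\in\mathfrak P_r$, $\xi\in\mathcal H(P,R)$, $\zeta\in\mathcal H(P',R)$, $x\in P$, $y\in P'$, the relation $\alpha_{P,\xi}(x)\le_+\alpha_{P',\zeta}(y)$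 implies $\alpha_{P,\rho_P(\xi)}(x)\le_+\alpha_{P',\rho_{P'}(\zeta)}(y)$, and likewise with $<_+$ in place of $\le_+$ on both sides. Write $R\sqsubseteq_G S$ (respectively $R\sqsubseteq_I S$) if there is a strong G-scheme (respectively a strong I-scheme) from $R$ to $S$. Theorem. Let $Q,R,S$ be non-empty finite posets such that the carrier of $Q$ is disjoint from those of $R$ and $S$. Then: 1. $R\oplus Q\sqsubseteq_G S\oplus Q$ implies $R\sqsubseteq_G S$. 2. Suppose $R\oplus Q\sqsubseteq_I S\oplus Q$, and let $\epsilon:\mathcal E(R\oplus Q)\to\mathcal E(S\oplus Q)$ be a one-to-one homomorphism such that $\alpha_{P,\eta(\xi)}(x)=\epsilon(\alpha_{P,\xi}(x))$ for all $P\in\mathfrak P_r$, $\xi\in\mathcal H(P,R\oplus Q)$, $x\in P$, where $\eta(\xi)\in\mathcal H(P,S\oplus Q)$ is given by $\eta(\xi)(x)=\epsilon(\alpha_{P,\xi}(x))_1$. Let $X$ and $Y$ be the carriers of $R$ and $Q$, and let $\mathcal E(Q)_*=\{(x,D\cup X,U):(x,D,U)\in\mathcal E(Q)\}\subseteq\mathcal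 E(R\oplus Q)$. If $Y\subseteq\epsilon(\mathcal E(Q)_*)_1=\{\epsilon(\mathfrak a)_1:\mathfrak a\in\mathcal E(Q)_*\}$, then $R\sqsubseteq_I S$. -/

import Mathlib

universe u

namespace HomScheme

section Poset

variable {P R S : Type u} [PartialOrder P] [PartialOrder R] [PartialOrder S]

/-- The punctured down-set of `A`: the elements below some element of `A`, without `A`. -/
def punctDown (A : Set P) : Set P := {y | ∃ a ∈ A, y ≤ a} \ A

/-- The punctured up-set of `A`: the elements above some element of `A`, without `A`. -/
def punctUp (A : Set P) : Set P := {y | ∃ a ∈ A, a ≤ y} \ A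

/-- `gammaSet A x` is the set of the `y ∈ A` which are connected with `x ∈ A` by a zigzag line
running inside of `A`. -/
def gammaSet (A : Set P) (x : P) : Set P :=
  {y | x ∈ A ∧ Relation.ReflTransGen (fun a b => a ∈ A ∧ b ∈ A ∧ (a < b ∨ b < a)) x y}

/-- `fiberComp ξ x` is the connectivity component of `x` in the fiber of `ξ` through `x`. -/
def fiberComp {Y : Type u} (ξ : P → Y) (x : P) : Set P := gammaSet (ξ ⁻¹' {ξ x}) x

variable (P) in
/-- The EV-system of `P`: the triples `(x, D, U)` with `x ∈ P`, `D` contained in the punctured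
down-set of `x`, and `U` contained in the punctured up-set of `x`. -/
@[ext]
structure EV where
  pt : P
  dn : Set P
  up : Set P
  dn_subset : dn ⊆ punctDown {pt}
  up_subset : up ⊆ punctUp {pt}

/-- The strict relation on the EV-system. -/
def EV.Lt (a b : EV P) : Prop := a.pt ∈ b.dn ∧ b.pt ∈ a.up

/-- The reflexive relation on the EV-system. -/
def EV.Le (a b : EV P) : Prop := a.Lt b ∨ a = b

/-- Homomorphisms between EV-systems (with respect to the reflexive relations). -/
def IsEVHom (ε : EV R → EV S) : Prop := ∀ a b : EV R, a.Le b → (ε a).Le (ε b)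

theorem self_mem_fiberComp {Y : Type u} (ξ : P → Y) (x : P) : x ∈ fiberComp ξ x :=
  ⟨rfl, Relation.ReflTransGen.refl⟩

theorem eq_of_mem_fiberComp {Y : Type u} {ξ : P → Y} {x y : P} (h : y ∈ fiberComp ξ x) :
    ξ y = ξ x := by
  obtain ⟨_, h⟩ := h
  induction h with
  | refl => rfl
  | tail _ h _ => exact h.2.1

theorem mem_fiberComp_of_comparable {Y : Type u} {ξ : P → Y} {x y z : P}
    (hy : y ∈ fiberComp ξ x) (hz : z ≤ y ∨ y ≤ z) (h : ξ z = ξ x) : z ∈ fiberComp ξ x := by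
  by_cases hzy : z = y
  · exact hzy ▸ hy
  · refine ⟨rfl, hy.2.tail ⟨eq_of_mem_fiberComp hy, h, ?_⟩⟩
    rcases hz with hz | hz
    · exact Or.inr (lt_of_le_of_ne hz hzy)
    · exact Or.inl (lt_of_le_of_ne hz (Ne.symm hzy))

/-- The map `α_{P,ξ} : P → ℰ(R)` belonging to a homomorphism `ξ : P → R`. -/
def alpha (ξ : P →o R) (x : P) : EV R where
  pt := ξ x
  dn := ξ '' punctDown (fiberComp ξ x)
  up := ξ '' punctUp (fiberComp ξ x)
  dn_subset := by
    rintro _ ⟨y, ⟨⟨a, ha, hya⟩, hy⟩, rfl⟩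
    have h1 : ξ y ≤ ξ x := eq_of_mem_fiberComp ha ▸ ξ.monotone hya
    exact ⟨⟨ξ x, rfl, h1⟩, fun h => hy (mem_fiberComp_of_comparable ha (Or.inl hya) h)⟩
  up_subset := by
    rintro _ ⟨y, ⟨⟨a, ha, hya⟩, hy⟩, rfl⟩
    have h1 : ξ x ≤ ξ y := eq_of_mem_fiberComp ha ▸ ξ.monotone hya
    exact ⟨⟨ξ x, rfl, h1⟩, fun h => hy (mem_fiberComp_of_comparable ha (Or.inr hya) h)⟩

theorem fiberComp_eq_of_le {Y : Type u} {ξ : P → Y} {x y : P} (hxy : x ≤ y) (h : ξ x = ξ y) :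
    fiberComp ξ x = fiberComp ξ y := by
  have hy : y ∈ fiberComp ξ x :=
    mem_fiberComp_of_comparable (self_mem_fiberComp ξ x) (Or.inr hxy) h.symm
  have hx : x ∈ fiberComp ξ y :=
    mem_fiberComp_of_comparable (self_mem_fiberComp ξ y) (Or.inl hxy) h
  ext z
  have e : ξ ⁻¹' {ξ x} = ξ ⁻¹' {ξ y} := by rw [h]
  constructor
  · intro hz
    refine ⟨rfl, hx.2.trans ?_⟩
    rw [← e]
    exact hz.2
  · intro hz
    refine ⟨rfl, hy.2.trans ?_⟩
    rw [e]
    exact hz.2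

theorem alpha_le (ξ : P →o R) {x y : P} (hxy : x ≤ y) : (alpha ξ x).Le (alpha ξ y) := by
  by_cases h : ξ x = ξ y
  · right
    have hG := fiberComp_eq_of_le hxy h
    ext1
    · exact h
    · simp only [alpha, hG]
    · simp only [alpha, hG]
  · left
    exact ⟨⟨x, ⟨⟨y, self_mem_fiberComp ξ y, hxy⟩, fun hx => h (eq_of_mem_fiberComp hx)⟩, rfl⟩,
      ⟨y, ⟨⟨x, self_mem_fiberComp ξ x, hxy⟩, fun hy => h (eq_of_mem_fiberComp hy).symm⟩, rfl⟩⟩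

theorem EV.Le.pt_le {a b : EV P} (h : a.Le b) : a.pt ≤ b.pt := by
  rcases h with h | rfl
  · obtain ⟨⟨c, rfl, hc⟩, _⟩ := b.dn_subset h.1
    exact hc
  · exact le_rfl

/-- For a homomorphism `ε : ℰ(R) → ℰ(S)` and `ξ : P → R`, the homomorphism `η(ξ) : P → S` given by
`η(ξ)(x) = ε(α_{P,ξ}(x))₁`. -/
def etaHom (ε : EV R → EV S) (hε : IsEVHom ε) (ξ : P →o R) : P →o S where
  toFun x := (ε (alpha ξ x)).pt
  monotone' _ _ hxy := (hε _ _ (alpha_le ξ hxy)).pt_le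

end Poset

/-- A representation system of the non-empty finite posets: a family of non-empty finite posets
containing exactly one isomorphic copy of each non-empty finite poset. -/
def IsRepSystem (𝓡 : Set FinPartOrd.{u}) : Prop :=
  (∀ P ∈ 𝓡, Nonempty P) ∧
    ∀ P : FinPartOrd.{u}, Nonempty P → ∃! P' : FinPartOrd.{u}, P' ∈ 𝓡 ∧ Nonempty (P ≃o P')

theorem exists_isRepSystem : ∃ 𝓡 : Set FinPartOrd.{u}, IsRepSystem 𝓡 := by
  let st : Setoid {P : FinPartOrd.{u} // Nonempty P} :=
    { r := fun P P' => Nonempty (P.1 ≃o P'.1)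
      iseqv := ⟨fun _ => ⟨OrderIso.refl _⟩, fun ⟨e⟩ => ⟨e.symm⟩, fun ⟨e⟩ ⟨f⟩ => ⟨e.trans f⟩⟩ }
  refine ⟨Set.range fun q : Quotient st => q.out.1, ?_, ?_⟩
  · rintro _ ⟨q, rfl⟩
    exact q.out.2
  · intro P hP
    refine ⟨(Quotient.mk st ⟨P, hP⟩).out.1, ⟨⟨_, rfl⟩, ?_⟩, ?_⟩
    · obtain ⟨e⟩ := Quotient.mk_out (s := st) ⟨P, hP⟩
      exact ⟨e.symm⟩
    · rintro _ ⟨⟨q, rfl⟩, ⟨e⟩⟩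
      have h : Quotient.mk st ⟨P, hP⟩ = q := by
        rw [← q.out_eq]
        exact Quotient.sound ⟨e⟩
      rw [h]

section Schemes

variable (𝓡 : Set FinPartOrd.{u}) (R S : Type u) [PartialOrder R] [PartialOrder S]

/-- Hom-schemes from `R` to `S`. -/
abbrev Scheme : Type (u + 1) := ∀ P : 𝓡, (P.1 →o R) → (P.1 →o S)

variable {𝓡 R S}

/-- Strong Hom-schemes. -/
def Scheme.IsStrong (ρ : Scheme 𝓡 R S) : Prop := ∀ P : 𝓡, Function.Injective (ρ P)

/-- G-schemes. -/
def Scheme.IsG (ρ : Scheme 𝓡 R S) : Prop :=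
  ∀ (P : 𝓡) (ξ : P.1 →o R) (x : P.1), fiberComp (ρ P ξ) x = fiberComp ξ x

/-- I-schemes (image-controlled Hom-schemes). -/
def Scheme.IsI (ρ : Scheme 𝓡 R S) : Prop :=
  ∀ (P Q : 𝓡) (ξ : P.1 →o R) (ζ : Q.1 →o R) (x : P.1) (y : Q.1),
    ((alpha ξ x).Le (alpha ζ y) → (alpha (ρ P ξ) x).Le (alpha (ρ Q ζ) y)) ∧
    ((alpha ξ x).Lt (alpha ζ y) → (alpha (ρ P ξ) x).Lt (alpha (ρ Q ζ) y))

variable (𝓡 R S)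

/-- `R ⊑_G S`: there is a strong G-scheme from `R` to `S`. -/
def GRel : Prop := ∃ ρ : Scheme 𝓡 R S, ρ.IsStrong ∧ ρ.IsG

/-- `R ⊑_I S`: there is a strong I-scheme from `R` to `S`. -/
def IRel : Prop := ∃ ρ : Scheme 𝓡 R S, ρ.IsStrong ∧ ρ.IsI

variable {R S}

/-- The property `α_{P,η(ξ)}(x) = ε(α_{P,ξ}(x))` (for all `P`, `ξ`, `x`) of a homomorphism
`ε : ℰ(R) → ℰ(S)`, where `η(ξ)(x) = ε(α_{P,ξ}(x))₁`. -/
def IsInducing (ε : EV R → EV S) (hε : IsEVHom ε) : Prop :=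
  ∀ (P : 𝓡) (ξ : P.1 →o R) (x : P.1), alpha (etaHom ε hε ξ) x = ε (alpha ξ x)

end Schemes

/-- The subset `ℰ(Q)_*` of `ℰ(R ⊕ Q)`: the triples `(x, D ∪ X, U)` with `(x, D, U) ∈ ℰ(Q)`, where
`X` is the carrier of `R`. -/
def lowerStar (R Q : Type u) [PartialOrder R] [PartialOrder Q] : Set (EV (R ⊕ₗ Q)) :=
  {a | ∃ q : EV Q, a.pt = Sum.inrₗ q.pt ∧
    a.dn = (fun y : Q => (Sum.inrₗ y : R ⊕ₗ Q)) '' q.dn ∪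
      Set.range (fun x : R => (Sum.inlₗ x : R ⊕ₗ Q)) ∧
    a.up = (fun y : Q => (Sum.inrₗ y : R ⊕ₗ Q)) '' q.up}

end HomScheme

/-! Part 1 is a counting argument. A strong G-scheme from `R` to `S` exists exactly when, for each
`P` and each prescribed family `θ` of fibre components, at most as many maps `P → R` as maps `P → S`
have components `θ`. Fix `θ`, with counts m and n, and test the hypothesis on (k disjoint copies of
`P`) ⊕ `Q`, with `θ` on each copy and singletons on `Q`. Adjoining the identity of `Q` to k maps
into `R` gives at least m^k maps into `R ⊕ Q`. In a map into `S ⊕ Q` with these components every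
copy lands in `S`, since otherwise `Q` would contain an infinite chain; so there are at most n^k * C
such maps, with C independent of k. Thus m^k ≤ n^k * C for all k, and m ≤ n.

For part 2, (x, D, U) in ℰ(R) is extended to (x, D, U ∪ Y), which lies strictly below all of ℰ(Q)_*.
The injective `ε` preserves strictness, so by the hypothesis on Y its value at an extended triple
has all of Y in the third component and is itself extended from ℰ(S). Therefore η(ξ ⊕ id) splits as
ρ(ξ) ⊕ g with g surjective. The maps ρ form the required scheme, because extension is injective and
both preserves and reflects the relations. -/

namespace HomScheme

/-! ### Fibre components and EV-systems of ordinal sums. -/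

section Basic

variable {P P' R S Q T : Type u} [PartialOrder P] [PartialOrder P'] [PartialOrder R]
  [PartialOrder S] [PartialOrder Q] [PartialOrder T]

/-- Components of fibers are transported along an embedding whose range is closed under
comparability inside of the fibers. -/
theorem fiberComp_image {Y Y' : Type u} (e : P ↪o P') {ξ : P → Y} {ξ' : P' → Y'}
    (h : ∀ x y, ξ' (e x) = ξ' (e y) ↔ ξ x = ξ y)
    (hr : ∀ x z, (z ≤ e x ∨ e x ≤ z) → ξ' z = ξ' (e x) → z ∈ Set.range e) (x : P) :
    fiberComp ξ' (e x) = e '' fiberComp ξ x := by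
  apply Set.Subset.antisymm
  · rintro z ⟨_, hz⟩
    induction hz with
    | refl => exact ⟨x, self_mem_fiberComp ξ x, rfl⟩
    | @tail b c _ hbc ih =>
      obtain ⟨y, hy, rfl⟩ := ih
      obtain ⟨hb, hc, hlt⟩ := hbc
      have hb' : ξ' (e y) = ξ' (e x) := hb
      have hc' : ξ' c = ξ' (e x) := hc
      obtain ⟨w, rfl⟩ := hr y c (hlt.symm.imp le_of_lt le_of_lt) (hc'.trans hb'.symm)
      refine ⟨w, mem_fiberComp_of_comparable hy ?_ ((h _ _).1 hc'), rfl⟩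
      exact hlt.symm.imp (fun h => e.le_iff_le.1 h.le) (fun h => e.le_iff_le.1 h.le)
  · rintro _ ⟨z, ⟨_, hz⟩, rfl⟩
    induction hz with
    | refl => exact self_mem_fiberComp ξ' (e x)
    | @tail b c _ hbc ih =>
      obtain ⟨_, hc, hlt⟩ := hbc
      refine mem_fiberComp_of_comparable ih ?_ ((h _ _).2 hc)
      exact hlt.symm.imp (fun h => e.le_iff_le.2 h.le) (fun h => e.le_iff_le.2 h.le)

theorem fiberComp_of_injective {Y : Type u} {ξ : P → Y} (h : Function.Injective ξ) (x : P) :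
    fiberComp ξ x = {x} := by
  ext y
  constructor
  · exact fun hy => h (eq_of_mem_fiberComp hy)
  · rintro rfl
    exact self_mem_fiberComp ξ y

theorem fiberComp_comp_orderIso {Y : Type u} (e : P ≃o P') (ξ : P' → Y) (x : P) :
    fiberComp ξ (e x) = e '' fiberComp (ξ ∘ e) x :=
  fiberComp_image (e : P ↪o P') (fun _ _ => Iff.rfl) (fun _ z _ _ => e.surjective z) x

theorem punctDown_image_orderIso (e : P ≃o P') (A : Set P) :
    punctDown (e '' A) = e '' punctDown A := by
  ext z
  obtain ⟨y, rfl⟩ := e.surjective z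
  simp [punctDown]

theorem punctUp_image_orderIso (e : P ≃o P') (A : Set P) :
    punctUp (e '' A) = e '' punctUp A := by
  ext z
  obtain ⟨y, rfl⟩ := e.surjective z
  simp [punctUp]

theorem alpha_comp_orderIso (e : P ≃o P') (ξ : P' →o R) (x : P) :
    alpha (ξ.comp (e : P →o P')) x = alpha ξ (e x) := by
  have h := fiberComp_comp_orderIso e ξ x
  ext1
  · rfl
  · change (ξ ∘ e) '' punctDown (fiberComp (ξ ∘ e) x) = ξ '' punctDown (fiberComp ξ (e x))
    rw [h, punctDown_image_orderIso, Set.image_image]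
    rfl
  · change (ξ ∘ e) '' punctUp (fiberComp (ξ ∘ e) x) = ξ '' punctUp (fiberComp ξ (e x))
    rw [h, punctUp_image_orderIso, Set.image_image]
    rfl

theorem EV.not_lt_self (a : EV P) : ¬ a.Lt a := fun h => (a.dn_subset h.1).2 rfl

/-- Injectivity excludes the collapse of a strict pair to equality, as the strict relation is
irreflexive. -/
theorem IsEVHom.map_lt {ε : EV R → EV S} (hε : IsEVHom ε) (hi : Function.Injective ε)
    {a b : EV R} (h : a.Lt b) : (ε a).Lt (ε b) := by
  rcases hε a b (Or.inl h) with h' | h'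
  · exact h'
  · rw [hi h'] at h
    exact (b.not_lt_self h).elim

/-- The embedding of the lower summand into an ordinal sum. -/
def inlEmb (P Q : Type u) [PartialOrder P] [PartialOrder Q] : P ↪o P ⊕ₗ Q where
  toFun := Sum.inlₗ
  inj' _ _ h := Sum.inl_injective (toLex.injective h)
  map_rel_iff' := Sum.Lex.inl_le_inl_iff

/-- The embedding of the upper summand into an ordinal sum. -/
def inrEmb (P Q : Type u) [PartialOrder P] [PartialOrder Q] : Q ↪o P ⊕ₗ Q where
  toFun := Sum.inrₗ
  inj' _ _ h := Sum.inr_injective (toLex.injective h)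
  map_rel_iff' := Sum.Lex.inr_le_inr_iff

theorem exists_inlEmb_or_inrEmb (z : P ⊕ₗ Q) :
    (∃ p, z = inlEmb P Q p) ∨ ∃ q, z = inrEmb P Q q := by
  rcases z with p | q
  · exact Or.inl ⟨p, rfl⟩
  · exact Or.inr ⟨q, rfl⟩

theorem inlEmb_ne_inrEmb (p : P) (q : Q) : inlEmb P Q p ≠ inrEmb P Q q :=
  fun h => Sum.inl_ne_inr (toLex.injective h)

theorem inlEmb_le_inrEmb (p : P) (q : Q) : inlEmb P Q p ≤ inrEmb P Q q :=
  Sum.Lex.inl_le_inr p q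

theorem not_inrEmb_le_inlEmb (p : P) (q : Q) : ¬ inrEmb P Q q ≤ inlEmb P Q p :=
  Sum.Lex.not_inr_le_inl

/-- The ordinal sum of two homomorphisms. -/
def lexSumHom (f : P →o R) (g : Q →o T) : P ⊕ₗ Q →o R ⊕ₗ T where
  toFun z := toLex (Sum.map f g (ofLex z))
  monotone' a b hab := by
    obtain ⟨p, rfl⟩ | ⟨q, rfl⟩ := exists_inlEmb_or_inrEmb a <;>
    obtain ⟨p', rfl⟩ | ⟨q', rfl⟩ := exists_inlEmb_or_inrEmb b
    · exact (inlEmb R T).le_iff_le.2 (f.monotone ((inlEmb P Q).le_iff_le.1 hab))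
    · exact inlEmb_le_inrEmb (f p) (g q')
    · exact (not_inrEmb_le_inlEmb _ _ hab).elim
    · exact (inrEmb R T).le_iff_le.2 (g.monotone ((inrEmb P Q).le_iff_le.1 hab))

theorem fiberComp_lexSumHom_inlEmb (f : P →o R) (g : Q →o T) (p : P) :
    fiberComp (lexSumHom f g) (inlEmb P Q p) = inlEmb P Q '' fiberComp f p := by
  refine fiberComp_image (inlEmb P Q) (fun x y => (inlEmb R T).injective.eq_iff) ?_ p
  intro x z _ hz
  obtain ⟨p, rfl⟩ | ⟨q, rfl⟩ := exists_inlEmb_or_inrEmb z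
  · exact ⟨p, rfl⟩
  · exact (inlEmb_ne_inrEmb _ _ hz.symm).elim

theorem fiberComp_lexSumHom_inrEmb (f : P →o R) (g : Q →o T) (q : Q) :
    fiberComp (lexSumHom f g) (inrEmb P Q q) = inrEmb P Q '' fiberComp g q := by
  refine fiberComp_image (inrEmb P Q) (fun x y => (inrEmb R T).injective.eq_iff) ?_ q
  intro x z _ hz
  obtain ⟨p, rfl⟩ | ⟨q, rfl⟩ := exists_inlEmb_or_inrEmb z
  · exact (inlEmb_ne_inrEmb _ _ hz).elim
  · exact ⟨q, rfl⟩

theorem punctDown_inlEmb_image (A : Set P) :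
    punctDown (inlEmb P Q '' A) = inlEmb P Q '' punctDown A := by
  ext z
  obtain ⟨p, rfl⟩ | ⟨q, rfl⟩ := exists_inlEmb_or_inrEmb z
  · simp [punctDown]
  · simp [punctDown, not_inrEmb_le_inlEmb, inlEmb_ne_inrEmb]

theorem punctUp_inlEmb_image {A : Set P} (hA : A.Nonempty) :
    punctUp (inlEmb P Q '' A) = inlEmb P Q '' punctUp A ∪ Set.range (inrEmb P Q) := by
  ext z
  obtain ⟨p, rfl⟩ | ⟨q, rfl⟩ := exists_inlEmb_or_inrEmb z
  · simp [punctUp, (inlEmb_ne_inrEmb _ _).symm]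
  · simpa [punctUp, inlEmb_le_inrEmb, inlEmb_ne_inrEmb, Set.Nonempty] using hA

/-- The element `(x, D, U ∪ Y)` of the EV-system of `R ⊕ Q` belonging to `(x, D, U) ∈ ℰ(R)`, where
`Y` is the carrier of `Q`. -/
def EV.extend (Q : Type u) [PartialOrder Q] (a : EV R) : EV (R ⊕ₗ Q) where
  pt := inlEmb R Q a.pt
  dn := inlEmb R Q '' a.dn
  up := inlEmb R Q '' a.up ∪ Set.range (inrEmb R Q)
  dn_subset := by
    rw [← Set.image_singleton, punctDown_inlEmb_image]
    exact Set.image_mono a.dn_subset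
  up_subset := by
    rw [← Set.image_singleton, punctUp_inlEmb_image (Set.singleton_nonempty _)]
    exact Set.union_subset_union_left _ (Set.image_mono a.up_subset)

theorem inlEmb_preimage_extend_up (a : EV R) : inlEmb R Q ⁻¹' (a.extend Q).up = a.up := by
  ext x
  simp [EV.extend, (inlEmb_ne_inrEmb _ _).symm]

theorem inlEmb_preimage_extend_dn (a : EV R) : inlEmb R Q ⁻¹' (a.extend Q).dn = a.dn :=
  Set.preimage_image_eq _ (inlEmb R Q).injective

theorem EV.extend_injective : Function.Injective (EV.extend Q : EV R → EV (R ⊕ₗ Q)) := by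
  intro a b h
  ext1
  · exact (inlEmb R Q).injective (congrArg EV.pt h)
  · rw [← inlEmb_preimage_extend_dn (Q := Q), h, inlEmb_preimage_extend_dn]
  · rw [← inlEmb_preimage_extend_up (Q := Q), h, inlEmb_preimage_extend_up]

theorem EV.extend_lt_extend {a b : EV R} : (a.extend Q).Lt (b.extend Q) ↔ a.Lt b := by
  refine and_congr ?_ ?_
  · exact Set.ext_iff.1 (inlEmb_preimage_extend_dn b) a.pt
  · exact Set.ext_iff.1 (inlEmb_preimage_extend_up a) b.pt

theorem EV.extend_le_extend {a b : EV R} : (a.extend Q).Le (b.extend Q) ↔ a.Le b :=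
  or_congr EV.extend_lt_extend EV.extend_injective.eq_iff

/-- An element of the EV-system of `S ⊕ Q` whose third component contains the carrier of `Q` comes
from the EV-system of `S`. -/
theorem EV.exists_extend_eq [Nonempty Q] (b : EV (S ⊕ₗ Q))
    (hb : Set.range (inrEmb S Q) ⊆ b.up) : ∃ c : EV S, c.extend Q = b := by
  obtain ⟨s, hs⟩ | ⟨q, hq⟩ := exists_inlEmb_or_inrEmb b.pt
  · have hdn : b.dn ⊆ inlEmb S Q '' punctDown {s} := by
      rw [← punctDown_inlEmb_image, Set.image_singleton, ← hs]
      exact b.dn_subset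
    have hup : b.up ⊆ inlEmb S Q '' punctUp {s} ∪ Set.range (inrEmb S Q) := by
      rw [← punctUp_inlEmb_image (Set.singleton_nonempty s), Set.image_singleton, ← hs]
      exact b.up_subset
    refine ⟨⟨s, inlEmb S Q ⁻¹' b.dn, inlEmb S Q ⁻¹' b.up, ?_, ?_⟩, ?_⟩
    · intro x hx
      obtain ⟨y, hy, hyx⟩ := hdn hx
      exact (inlEmb S Q).injective hyx ▸ hy
    · intro x hx
      rcases hup hx with ⟨y, hy, hyx⟩ | ⟨y, hyx⟩
      · exact (inlEmb S Q).injective hyx ▸ hy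
      · exact (inlEmb_ne_inrEmb _ _ hyx.symm).elim
    · ext1
      · exact hs.symm
      · exact Set.image_preimage_eq_of_subset (hdn.trans (Set.image_subset_range _ _))
      · apply Set.Subset.antisymm
        · exact Set.union_subset (Set.image_preimage_subset _ _) hb
        · intro z hz
          obtain ⟨x, rfl⟩ | ⟨y, rfl⟩ := exists_inlEmb_or_inrEmb z
          · exact Or.inl ⟨x, hz, rfl⟩
          · exact Or.inr ⟨y, rfl⟩
  -- A base point in `Q` would belong to its own punctured up-set.
  · exact ((b.up_subset (hb ⟨q, rfl⟩)).2 hq.symm).elim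

/-- All of `Q` lies above every component in `P`, so surjectivity of `g` puts the whole of `T` into
the third component. -/
theorem alpha_lexSumHom_inlEmb (f : P →o R) {g : Q →o T} (hg : Function.Surjective g) (p : P) :
    alpha (lexSumHom f g) (inlEmb P Q p) = (alpha f p).extend T := by
  have h := fiberComp_lexSumHom_inlEmb f g p
  ext1
  · rfl
  · change lexSumHom f g '' punctDown (fiberComp (lexSumHom f g) (inlEmb P Q p)) =
      inlEmb R T '' (f '' punctDown (fiberComp f p))
    rw [h, punctDown_inlEmb_image, Set.image_image, Set.image_image]
    rfl
  · change lexSumHom f g '' punctUp (fiberComp (lexSumHom f g) (inlEmb P Q p)) =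
      inlEmb R T '' (f '' punctUp (fiberComp f p)) ∪ Set.range (inrEmb R T)
    rw [h, punctUp_inlEmb_image ⟨p, self_mem_fiberComp _ p⟩, Set.image_union, Set.image_image,
      Set.image_image, ← Set.range_comp, ← hg.range_comp]
    rfl

theorem EV.extend_lt_of_mem_lowerStar (a : EV R) {b : EV (R ⊕ₗ Q)} (hb : b ∈ lowerStar R Q) :
    (a.extend Q).Lt b := by
  obtain ⟨q, hpt, hdn, _⟩ := hb
  constructor
  · rw [hdn]
    exact Or.inr ⟨a.pt, rfl⟩
  · rw [hpt]
    exact Or.inr ⟨q.pt, rfl⟩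

end Basic

/-! ### Passage from the representation system to arbitrary posets, and G-schemes as cardinal
inequalities. -/

section Transport

variable {𝓡 : Set FinPartOrd.{u}} {R S : Type u} [PartialOrder R] [PartialOrder S]

theorem IsRepSystem.exists_orderIso (h𝓡 : IsRepSystem 𝓡) (P : Type u) [PartialOrder P] [Finite P]
    [Nonempty P] : ∃ P' : 𝓡, Nonempty (P ≃o P'.1) := by
  have := Fintype.ofFinite P
  obtain ⟨P', ⟨h1, h2⟩, _⟩ := h𝓡.2 (FinPartOrd.of P) ‹_›
  exact ⟨⟨P', h1⟩, h2⟩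

/-- Needed because ordinal sums such as `P ⊕ₗ Q` need not belong to `𝓡`. -/
theorem IsInducing.alpha_etaHom (h𝓡 : IsRepSystem 𝓡) {ε : EV R → EV S} {hε : IsEVHom ε}
    (h : IsInducing 𝓡 ε hε) {P : Type u} [PartialOrder P] [Finite P] [Nonempty P] (ξ : P →o R)
    (x : P) : alpha (etaHom ε hε ξ) x = ε (alpha ξ x) := by
  obtain ⟨P', ⟨e⟩⟩ := h𝓡.exists_orderIso P
  have h1 := h P' (ξ.comp (e.symm : P'.1 →o P)) (e x)
  have h2 : etaHom ε hε (ξ.comp (e.symm : P'.1 →o P)) =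
      (etaHom ε hε ξ).comp (e.symm : P'.1 →o P) := by
    ext y
    change (ε (alpha (ξ.comp (e.symm : P'.1 →o P)) y)).pt = (ε (alpha ξ (e.symm y))).pt
    rw [alpha_comp_orderIso]
  rw [h2, alpha_comp_orderIso, alpha_comp_orderIso, e.symm_apply_apply] at h1
  exact h1

/-- The homomorphisms whose components of fibers are given by `θ`. -/
abbrev FiberClass {P : Type u} [PartialOrder P] (θ : P → Set P) (R : Type u) [PartialOrder R] :
    Type u := {ξ : P →o R // ∀ x, fiberComp ξ x = θ x}

/-- A strong G-scheme, carried along an isomorphism, restricts to an injection between the classes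
with components `θ`. -/
theorem GRel.card_fiberClass_le (h𝓡 : IsRepSystem 𝓡) [Finite S] (h : GRel 𝓡 R S) {P : Type u}
    [PartialOrder P] [Finite P] [Nonempty P] (θ : P → Set P) :
    Nat.card (FiberClass θ R) ≤ Nat.card (FiberClass θ S) := by
  obtain ⟨ρ, hs, hG⟩ := h
  obtain ⟨P', ⟨e⟩⟩ := h𝓡.exists_orderIso P
  have : Finite (P →o S) := DFunLike.finite _
  refine Nat.card_le_card_of_injective (fun ξ : FiberClass θ R =>
    (⟨(ρ P' (ξ.1.comp (e.symm : P'.1 →o P))).comp (e : P →o P'.1), fun x => ?_⟩ :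
      FiberClass θ S)) ?_
  · apply e.injective.image_injective
    rw [← ξ.2]
    refine (fiberComp_comp_orderIso e (ρ P' (ξ.1.comp (e.symm : P'.1 →o P))) x).symm.trans ?_
    rw [hG, fiberComp_comp_orderIso e]
    congr 2
    ext y
    simp
  · intro ξ ζ h
    have h1 : ξ.1.comp (e.symm : P'.1 →o P) = ζ.1.comp (e.symm : P'.1 →o P) := by
      apply hs P'
      ext y
      have := DFunLike.congr_fun (congrArg Subtype.val h) (e.symm y)
      simpa using this
    ext x
    have := DFunLike.congr_fun h1 (e x)
    simpa using this

/-- The classes partition the homomorphisms, so injections chosen class by class glue to a strong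
G-scheme. -/
theorem GRel.of_card_fiberClass_le [Finite R] [Finite S]
    (h : ∀ (P : 𝓡) (θ : P.1 → Set P.1), Nat.card (FiberClass θ R) ≤ Nat.card (FiberClass θ S)) :
    GRel 𝓡 R S := by
  have key : ∀ (P : 𝓡) (θ : P.1 → Set P.1), Nonempty (FiberClass θ R ↪ FiberClass θ S) := by
    intro P θ
    have : Finite (P.1 →o R) := DFunLike.finite _
    have : Finite (P.1 →o S) := DFunLike.finite _
    have := Fintype.ofFinite (FiberClass θ R)
    have := Fintype.ofFinite (FiberClass θ S)
    apply Function.Embedding.nonempty_of_card_le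
    rw [Fintype.card_eq_nat_card, Fintype.card_eq_nat_card]
    exact h P θ
  let f := fun P θ => (key P θ).some
  refine ⟨fun P ξ => (f P (fiberComp ξ) ⟨ξ, fun _ => rfl⟩).1, ?_, ?_⟩
  · intro P ξ ζ heq
    -- Equal images have equal components, hence come from the same class; stating this for variable
    -- `θ`, `θ'` avoids a dependent rewrite.
    have hval : ∀ (θ θ' : P.1 → Set P.1) (a : FiberClass θ R) (b : FiberClass θ' R), θ = θ' →
        (f P θ a).1 = (f P θ' b).1 → a.1 = b.1 := by
      rintro θ _ a b rfl hab
      exact congrArg Subtype.val ((f P θ).injective (Subtype.ext hab))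
    refine hval _ _ ⟨ξ, fun _ => rfl⟩ ⟨ζ, fun _ => rfl⟩ ?_ heq
    funext x
    rw [← (f P (fiberComp ξ) ⟨ξ, fun _ => rfl⟩).2 x, ← (f P (fiberComp ζ) ⟨ζ, fun _ => rfl⟩).2 x]
    exact congrArg (fun η : P.1 →o S => fiberComp η x) heq
  · exact fun P ξ x => (f P (fiberComp ξ) ⟨ξ, fun _ => rfl⟩).2 x

end Transport

/-! ### Counting homomorphisms on k copies of `P` below `Q`. -/

section Copies

variable {P Q R S : Type u} [PartialOrder P] [PartialOrder Q] [PartialOrder R] [PartialOrder S]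
  {k : ℕ}

/-- The disjoint union of `k` copies of `P`. -/
abbrev Copies (k : ℕ) (P : Type u) : Type u := Σ _ : Fin k, P

/-- The embedding of the copy with index `i` into the ordinal sum of `Copies k P` and `Q`. -/
def copyEmb (P Q : Type u) [PartialOrder P] [PartialOrder Q] (i : Fin k) :
    P ↪o Copies k P ⊕ₗ Q :=
  OrderEmbedding.ofMapLEIff (fun p => inlEmb (Copies k P) Q ⟨i, p⟩) fun _ _ =>
    (inlEmb (Copies k P) Q).le_iff_le.trans Sigma.mk_le_mk_iff

theorem copyEmb_apply (i : Fin k) (p : P) :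
    copyEmb P Q i p = inlEmb (Copies k P) Q ⟨i, p⟩ := rfl

/-- The homomorphism on the copies of `P` given by a family of homomorphisms. -/
def copiesHom (ξ : Fin k → (P →o R)) : Copies k P →o R where
  toFun z := ξ z.1 z.2
  monotone' := by
    rintro _ _ ⟨i, a, b, hab⟩
    exact (ξ i).monotone hab

theorem fiberComp_copiesHom (ξ : Fin k → (P →o R)) (i : Fin k) (p : P) :
    fiberComp (copiesHom ξ) ⟨i, p⟩ = (fun y => (⟨i, y⟩ : Copies k P)) '' fiberComp (ξ i) p := by
  let e : P ↪o Copies k P :=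
    OrderEmbedding.ofMapLEIff (fun p => ⟨i, p⟩) fun _ _ => Sigma.mk_le_mk_iff
  refine fiberComp_image e (fun _ _ => Iff.rfl) ?_ p
  rintro x z (⟨_, y, _, _⟩ | ⟨_, _, y, _⟩) _
  · exact ⟨y, rfl⟩
  · exact ⟨y, rfl⟩

/-- The components on `Copies k P ⊕ Q` given by `θ` on every copy of `P` and by singletons
on `Q`. -/
def copiesComp (θ : P → Set P) (z : Copies k P ⊕ₗ Q) : Set (Copies k P ⊕ₗ Q) :=
  Sum.elim (fun x => copyEmb P Q x.1 '' θ x.2) (fun q => {inrEmb (Copies k P) Q q}) (ofLex z)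

theorem copiesComp_copyEmb (θ : P → Set P) (i : Fin k) (p : P) :
    copiesComp θ (copyEmb P Q i p) = copyEmb P Q i '' θ p := rfl

theorem copiesComp_inrEmb (θ : P → Set P) (q : Q) :
    copiesComp θ (inrEmb (Copies k P) Q q) = {inrEmb (Copies k P) Q q} := rfl

theorem fiberComp_lexSumHom_copiesHom {θ : P → Set P} (ξ : Fin k → FiberClass θ R)
    (z : Copies k P ⊕ₗ Q) :
    fiberComp (lexSumHom (copiesHom fun i => (ξ i).1) (OrderHom.id : Q →o Q)) z =
      copiesComp θ z := by
  obtain ⟨⟨i, p⟩, rfl⟩ | ⟨q, rfl⟩ := exists_inlEmb_or_inrEmb z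
  · rw [fiberComp_lexSumHom_inlEmb, fiberComp_copiesHom, (ξ i).2, Set.image_image]
    rfl
  · rw [fiberComp_lexSumHom_inrEmb,
      fiberComp_of_injective (ξ := (OrderHom.id : Q →o Q)) (fun _ _ h => h), Set.image_singleton]
    rfl

/-- A homomorphism to `S ⊕ Q` which is strict on the upper summand `Q` maps everything properly
below the upper summand into `S`. -/
theorem exists_eq_inlEmb_of_fiberComp_eq_copiesComp [Finite Q] [Nonempty Q] {θ : P → Set P}
    {f : Copies k P ⊕ₗ Q →o S ⊕ₗ Q} (hf : ∀ z, fiberComp f z = copiesComp θ z)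
    (i : Fin k) (p : P) : ∃ s, f (copyEmb P Q i p) = inlEmb S Q s := by
  obtain h | ⟨q₀, hq₀⟩ := exists_inlEmb_or_inrEmb (f (copyEmb P Q i p))
  · exact h
  exfalso
  -- Components of points in a copy stay in that copy, so comparability with `Q` is strict after
  -- applying `f`.
  have hlt : ∀ q, f (copyEmb P Q i p) < f (inrEmb _ Q q) := by
    intro q
    have hle : copyEmb P Q i p ≤ inrEmb _ Q q := inlEmb_le_inrEmb _ _
    refine lt_of_le_of_ne (f.monotone hle) fun heq => ?_
    have hmem := mem_fiberComp_of_comparable (self_mem_fiberComp f _) (Or.inr hle) heq.symm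
    rw [hf, copiesComp_copyEmb] at hmem
    obtain ⟨y, _, hy⟩ := hmem
    exact inlEmb_ne_inrEmb _ _ hy
  have hg : ∀ q, ∃ q', f (inrEmb _ Q q) = inrEmb S Q q' := by
    intro q
    obtain ⟨s, hs⟩ | h := exists_inlEmb_or_inrEmb (f (inrEmb _ Q q))
    · have := (hlt q).le
      rw [hq₀, hs] at this
      exact (not_inrEmb_le_inlEmb _ _ this).elim
    · exact h
  choose g hg using hg
  have hmono : StrictMono g := by
    intro a b hab
    have hle : inrEmb (Copies k P) Q a ≤ inrEmb _ Q b :=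
      (inrEmb (Copies k P) Q).le_iff_le.2 hab.le
    refine (inrEmb S Q).lt_iff_lt.1 ?_
    rw [← hg, ← hg]
    refine lt_of_le_of_ne (f.monotone hle) fun heq => ?_
    have hmem := mem_fiberComp_of_comparable (self_mem_fiberComp f _) (Or.inr hle) heq.symm
    rw [hf, copiesComp_inrEmb] at hmem
    exact hab.ne' ((inrEmb _ Q).injective hmem)
  have h0 : q₀ < g q₀ := by
    have := hlt q₀
    rw [hq₀, hg] at this
    exact (inrEmb S Q).lt_iff_lt.1 this
  -- Iterating `g` from `q₀` would give an infinite ascending chain in the finite `Q`.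
  exact not_injective_infinite_finite _ (hmono.strictMono_iterate_of_lt_map h0).injective

theorem card_fiberClass_pow_le [Finite P] [Finite Q] [Finite R] (θ : P → Set P) (k : ℕ) :
    Nat.card (FiberClass θ R) ^ k ≤
      Nat.card (FiberClass (copiesComp (k := k) (Q := Q) θ) (R ⊕ₗ Q)) := by
  have : Finite (R ⊕ₗ Q) := inferInstanceAs (Finite (R ⊕ Q))
  have : Finite (Copies k P ⊕ₗ Q) := inferInstanceAs (Finite (Copies k P ⊕ Q))
  have : Finite (Copies k P ⊕ₗ Q →o R ⊕ₗ Q) := DFunLike.finite _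
  have hcard : Nat.card (Fin k → FiberClass θ R) = Nat.card (FiberClass θ R) ^ k := by
    rw [Nat.card_fun, Nat.card_fin]
  rw [← hcard]
  refine Nat.card_le_card_of_injective (fun ξ : Fin k → FiberClass θ R =>
    (⟨lexSumHom (copiesHom fun i => (ξ i).1) OrderHom.id, fiberComp_lexSumHom_copiesHom ξ⟩ :
      FiberClass (copiesComp (k := k) (Q := Q) θ) (R ⊕ₗ Q))) ?_
  intro ξ ζ h
  funext i
  ext p
  exact (inlEmb R Q).injective
    (DFunLike.congr_fun (congrArg Subtype.val h) (inlEmb (Copies k P) Q ⟨i, p⟩))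

/-- A map is determined by its k restrictions to the copies, which take values in `S`, and by its
values on `Q`, counted crudely as arbitrary functions. -/
theorem card_fiberClass_copiesComp_le [Finite P] [Finite Q] [Nonempty Q] [Finite S]
    (θ : P → Set P) (k : ℕ) :
    Nat.card (FiberClass (copiesComp (k := k) (Q := Q) θ) (S ⊕ₗ Q)) ≤
      Nat.card (FiberClass θ S) ^ k * Nat.card (Q → S ⊕ₗ Q) := by
  have : Finite (S ⊕ₗ Q) := inferInstanceAs (Finite (S ⊕ Q))
  have : Finite (P →o S) := DFunLike.finite _
  have hcard : Nat.card ((Fin k → FiberClass θ S) × (Q → S ⊕ₗ Q)) =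
      Nat.card (FiberClass θ S) ^ k * Nat.card (Q → S ⊕ₗ Q) := by
    rw [Nat.card_prod, Nat.card_fun (α := Fin k), Nat.card_fin]
  rw [← hcard]
  choose r hr using fun (f : FiberClass (copiesComp (k := k) (Q := Q) θ) (S ⊕ₗ Q)) =>
    exists_eq_inlEmb_of_fiberComp_eq_copiesComp f.2
  let res (f : FiberClass (copiesComp (k := k) (Q := Q) θ) (S ⊕ₗ Q)) (i : Fin k) : P →o S :=
    { toFun := r f i
      monotone' := fun a b hab => by
        rw [← (inlEmb S Q).le_iff_le, ← hr, ← hr]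
        exact f.1.monotone ((copyEmb P Q i).le_iff_le.2 hab) }
  have hres : ∀ f i x, fiberComp (res f i) x = θ x := by
    intro f i x
    apply (copyEmb P Q i).injective.image_injective
    change _ = copyEmb P Q i '' θ x
    rw [← copiesComp_copyEmb θ, ← f.2]
    refine (fiberComp_image (copyEmb P Q i) ?_ ?_ x).symm
    · intro a b
      rw [hr, hr]
      exact (inlEmb S Q).injective.eq_iff
    · intro a z hz heq
      have hmem := mem_fiberComp_of_comparable (self_mem_fiberComp f.1 _) hz heq
      rw [f.2, copiesComp_copyEmb] at hmem
      exact Set.image_subset_range _ _ hmem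
  refine Nat.card_le_card_of_injective (fun f =>
    ((fun i => ⟨res f i, hres f i⟩, fun q => f.1 (inrEmb _ Q q)) :
      (Fin k → FiberClass θ S) × (Q → S ⊕ₗ Q))) ?_
  intro f f' h
  apply Subtype.ext
  refine DFunLike.ext _ _ fun z => ?_
  obtain ⟨⟨i, p⟩, rfl⟩ | ⟨q, rfl⟩ := exists_inlEmb_or_inrEmb z
  · have h1 : r f i p = r f' i p :=
      DFunLike.congr_fun (congrArg Subtype.val (congrFun (congrArg Prod.fst h) i)) p
    rw [← copyEmb_apply, hr, hr, h1]
  · exact congrFun (congrArg Prod.snd h) q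

end Copies

/-! ### Letting k grow: the first assertion. -/

theorem le_of_forall_pow_le_mul {m n C : ℕ} (h : ∀ k, m ^ k ≤ n ^ k * C) : m ≤ n := by
  by_contra! hlt
  rcases Nat.eq_zero_or_pos n with rfl | hn
  · have := h 1
    simp at this
    omega
  · have h1 : (1 : ℝ) < (m : ℝ) / n := by
      rw [one_lt_div (by exact_mod_cast hn)]
      exact_mod_cast hlt
    obtain ⟨k, hk⟩ := pow_unbounded_of_one_lt (C : ℝ) h1
    have hnk : (0 : ℝ) < (n : ℝ) ^ k := by positivity
    rw [div_pow, lt_div_iff₀ hnk] at hk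
    have h2 : (m : ℝ) ^ k ≤ (n : ℝ) ^ k * C := by exact_mod_cast h k
    linarith

variable {𝓡 : Set FinPartOrd.{u}} {Q R S : Type u} [PartialOrder Q] [PartialOrder R]
  [PartialOrder S]

theorem GRel.of_lexSum (h𝓡 : IsRepSystem 𝓡) [Finite Q] [Finite R] [Finite S] [Nonempty Q]
    (h : GRel 𝓡 (R ⊕ₗ Q) (S ⊕ₗ Q)) : GRel 𝓡 R S := by
  refine GRel.of_card_fiberClass_le fun P θ =>
    le_of_forall_pow_le_mul (C := Nat.card (Q → S ⊕ₗ Q)) fun k => ?_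
  have : Finite (S ⊕ₗ Q) := inferInstanceAs (Finite (S ⊕ Q))
  have : Finite (Copies k P.1 ⊕ₗ Q) := inferInstanceAs (Finite (Copies k P.1 ⊕ Q))
  have : Nonempty (Copies k P.1 ⊕ₗ Q) := inferInstanceAs (Nonempty (Copies k P.1 ⊕ Q))
  exact (card_fiberClass_pow_le (Q := Q) θ k).trans
    ((h.card_fiberClass_le h𝓡 _).trans (card_fiberClass_copiesComp_le θ k))

/-! ### Splitting the induced homomorphisms: the second assertion. -/

section Inducing

variable [Nonempty Q] {ε : EV (R ⊕ₗ Q) → EV (S ⊕ₗ Q)} {hε : IsEVHom ε}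

theorem IsEVHom.exists_extend_eq (hε : IsEVHom ε) (hi : Function.Injective ε)
    (hY : Set.range (inrEmb S Q) ⊆ (fun a => (ε a).pt) '' lowerStar R Q) (a : EV R) :
    ∃ c : EV S, c.extend Q = ε (a.extend Q) := by
  refine EV.exists_extend_eq _ fun y hy => ?_
  obtain ⟨b, hb, rfl⟩ := hY hy
  exact (hε.map_lt hi (a.extend_lt_of_mem_lowerStar hb)).2

/-- Under `η`, the extension of `ξ : P → R` by the identity of `Q` becomes the ordinal sum of a
homomorphism `P → S` and a surjective endomorphism of `Q`. -/
theorem IsInducing.exists_etaHom_eq_lexSumHom [Finite Q] (h𝓡 : IsRepSystem 𝓡) (hind : IsInducing 𝓡 ε hε)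
    (hext : ∀ a : EV R, ∃ c : EV S, c.extend Q = ε (a.extend Q))
    {P : Type u} [PartialOrder P] [Finite P] [Nonempty P] (ξ : P →o R) :
    ∃ (η : P →o S) (g : Q →o Q), Function.Surjective g ∧
      etaHom ε hε (lexSumHom ξ OrderHom.id) = lexSumHom η g := by
  have : Finite (P ⊕ₗ Q) := inferInstanceAs (Finite (P ⊕ Q))
  have : Nonempty (P ⊕ₗ Q) := inferInstanceAs (Nonempty (P ⊕ Q))
  set F := etaHom ε hε (lexSumHom ξ (OrderHom.id : Q →o Q)) with hF
  choose c hc using hext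
  have hα : ∀ p, alpha F (inlEmb P Q p) = (c (alpha ξ p)).extend Q := by
    intro p
    rw [hF, hind.alpha_etaHom h𝓡, alpha_lexSumHom_inlEmb ξ Function.surjective_id, hc]
  have hl : ∀ p, F (inlEmb P Q p) = inlEmb S Q (c (alpha ξ p)).pt := fun p =>
    congrArg EV.pt (hα p)
  have hsurj : ∀ y, ∃ q, F (inrEmb P Q q) = inrEmb S Q y := by
    intro y
    -- The third component of an extended triple contains `Q` and consists of values of `F`; values
    -- on `P` lie in `S`, so each `y` is attained on `Q`.
    have hy : inrEmb S Q y ∈ (alpha F (inlEmb P Q (Classical.arbitrary P))).up := by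
      rw [hα]
      exact Or.inr ⟨y, rfl⟩
    obtain ⟨z, _, hz⟩ := hy
    obtain ⟨p, rfl⟩ | ⟨q, rfl⟩ := exists_inlEmb_or_inrEmb z
    · rw [hl] at hz
      exact (inlEmb_ne_inrEmb _ _ hz).elim
    · exact ⟨q, hz⟩
  choose t ht using hsurj
  -- The section `t` is an injective self-map of the finite `Q`, hence onto, so `F` maps no point of
  -- `Q` into `S`.
  have htinj : Function.Injective t := fun a b hab =>
    (inrEmb S Q).injective (by rw [← ht, ← ht, hab])
  have hr : ∀ q, ∃ y, F (inrEmb P Q q) = inrEmb S Q y := by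
    intro q
    obtain ⟨y, rfl⟩ := Finite.surjective_of_injective htinj q
    exact ⟨y, ht y⟩
  choose g hg using hr
  refine ⟨⟨fun p => (c (alpha ξ p)).pt, fun a b hab => ?_⟩, ⟨g, fun a b hab => ?_⟩,
    fun y => ⟨t y, (inrEmb S Q).injective ?_⟩, ?_⟩
  · rw [← (inlEmb S Q).le_iff_le, ← hl, ← hl]
    exact F.monotone ((inlEmb P Q).le_iff_le.2 hab)
  · rw [← (inrEmb S Q).le_iff_le, ← hg, ← hg]
    exact F.monotone ((inrEmb P Q).le_iff_le.2 hab)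
  · exact (hg (t y)).symm.trans (ht y)
  · refine DFunLike.ext _ _ fun z => ?_
    obtain ⟨p, rfl⟩ | ⟨q, rfl⟩ := exists_inlEmb_or_inrEmb z
    · exact hl p
    · exact hg q

theorem IRel.of_isInducing [Finite Q] (h𝓡 : IsRepSystem 𝓡) (hi : Function.Injective ε)
    (hind : IsInducing 𝓡 ε hε)
    (hY : Set.range (inrEmb S Q) ⊆ (fun a => (ε a).pt) '' lowerStar R Q) : IRel 𝓡 R S := by
  have hscheme : ∀ P : 𝓡, ∃ ρ : (P.1 →o R) → (P.1 →o S), ∀ ξ x,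
      (alpha (ρ ξ) x).extend Q = ε ((alpha ξ x).extend Q) := by
    intro P
    have := h𝓡.1 P.1 P.2
    have : Finite (P.1 ⊕ₗ Q) := inferInstanceAs (Finite (P.1 ⊕ Q))
    have : Nonempty (P.1 ⊕ₗ Q) := inferInstanceAs (Nonempty (P.1 ⊕ Q))
    choose ρ g hg hρ using fun ξ : P.1 →o R =>
      hind.exists_etaHom_eq_lexSumHom h𝓡 (hε.exists_extend_eq hi hY) ξ
    refine ⟨ρ, fun ξ x => ?_⟩
    rw [← alpha_lexSumHom_inlEmb (ρ ξ) (hg ξ), ← hρ, hind.alpha_etaHom h𝓡,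
      alpha_lexSumHom_inlEmb ξ Function.surjective_id]
  choose ρ hρ using hscheme
  refine ⟨ρ, ?_, ?_⟩
  · intro P ξ ζ h
    refine DFunLike.ext _ _ fun x => ?_
    have h1 : alpha ξ x = alpha ζ x := by
      apply EV.extend_injective (Q := Q)
      apply hi
      rw [← hρ, ← hρ, h]
    exact congrArg EV.pt h1
  · intro P P' ξ ζ x y
    rw [← EV.extend_le_extend (Q := Q) (b := alpha (ρ P' ζ) y),
      ← EV.extend_lt_extend (Q := Q) (b := alpha (ρ P' ζ) y), hρ, hρ]
    exact ⟨fun h => hε _ _ (EV.extend_le_extend.2 h),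
      fun h => hε.map_lt hi (EV.extend_lt_extend.2 h)⟩

end Inducing

end HomScheme

theorem theorem7 (𝓡 : Set FinPartOrd.{u}) (h𝓡 : HomScheme.IsRepSystem 𝓡)
    (Q R S : Type u) [PartialOrder Q] [PartialOrder R] [PartialOrder S]
    [Finite Q] [Finite R] [Finite S] [Nonempty Q] [Nonempty R] [Nonempty S] :
    (HomScheme.GRel 𝓡 (R ⊕ₗ Q) (S ⊕ₗ Q) → HomScheme.GRel 𝓡 R S) ∧
    (HomScheme.IRel 𝓡 (R ⊕ₗ Q) (S ⊕ₗ Q) →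
      ∀ (ε : HomScheme.EV (R ⊕ₗ Q) → HomScheme.EV (S ⊕ₗ Q)) (hε : HomScheme.IsEVHom ε),
        Function.Injective ε → HomScheme.IsInducing 𝓡 ε hε →
        Set.range (fun y : Q => (Sum.inrₗ y : S ⊕ₗ Q)) ⊆
          (fun a => (ε a).pt) '' HomScheme.lowerStar R Q →
        HomScheme.IRel 𝓡 R S) :=
  ⟨fun h => h.of_lexSum h𝓡, fun _ _ _ hi hind hY => HomScheme.IRel.of_isInducing h𝓡 hi hind hY⟩
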